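/- \textbf{Theorem.} Let $k\ge 1$, $n\ge 1$ and $d\ge 3$ be integers, let $A\in\mathbb R^{k\times n}$ have rank $k$, and let $\kappa_1,\dots,\kappa_n\in\mathbb R$ be pairwise distinct. For a matrix $M$ with $m$ rows and an $m$-element set $J$ of column indices, let $\Delta_M(J)$ be the determinant of the columns of $M$ indexed by $J$, taken in increasing order; for real numbers $\mu_\alpha$ indexed by a set containing $J$, put $V_\mu(J)=\prod_{\alpha<\beta;\ \alpha,\beta\in J}(\mu_\beta-\mu_\alpha)$, the Vandermonde determinant $\det(\mu_\alpha^{\,i-1})_{\alpha\in J,\,1\le i\le m}$. Put $$\mathfrak G=\{I\subseteq\{1,\dots,n\}:\ \#I=k,\ \Delta_A(I)\ne 0\},\qquad \mathfrak v=\bigcap_{I\in\mathfrak G}I .$$ A \emph{signature} is a map $\Sigma:\mathfrak G\to\{\pm1\}$; for a $k$-subset $I\notin\mathfrak G$ put $\Sigma(I)\Delta_A(I):=0$. The signature $\Sigma$ is called \emph{determinantal} if there exist real numbers $\tilde\kappa_\alpha$ $(\alpha\in\{1,\dots,n\}\setminus\mathfrak v)$, a real matrix $\tilde a$ with $k-\#\mathfrak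 v$ rows and with columns indexed by $\{1,\dots,n\}\setminus\mathfrak v$, and a nowhere vanishing function $\lambda:\mathbb R^d\to\mathbb R$ such that $$\Delta_{\tilde a}(I\setminus\mathfrak v)\,V_{\tilde\kappa}(I\setminus\mathfrak v)\,\exp\Big(\sum_{\alpha\in I\setminus\mathfrak v}\sum_{u=1}^d\tilde\kappa_\alpha^{\,u}x_u\Big)=\lambda(x)\,\Sigma(I)\,\Delta_A(I)\,V_\kappa(I)\,\exp\Big(\sum_{\alpha\in I}\sum_{u=1}^d\kappa_\alpha^{\,u}x_u\Big)$$ for all $x\in\mathbb R^d$ and all $k$-subsets $I$ of $\{1,\dots,n\}$ with $\mathfrak v\subseteq I$. (Every $I\in\mathfrak G$ contains $\mathfrak v$; for $I\notin\mathfrak G$ the condition says that the left-hand side vanishes.) The signature $\Sigma$ is \emph{induced by a choice of signs for the rows and columns of $A$, up to the action of $GL_k(\mathbb R)$}, if there are $\varrho\in\{\pm1\}^k$, $\chi\in\{\pm1\}^n$ and $G\in GL_k(\mathbb R)$ such that $\Delta_B(I)=\Sigma(I)\,\Delta_A(I)$ for all $I\in\mathfrak G$, where $B=G\cdot\mathrm{diag}(\varrho)\cdot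 A\cdot\mathrm{diag}(\chi)$. Then $\Sigma$ is determinantal if and only if it is induced by a choice of signs for the rows and columns of $A$, up to the action of $GL_k(\mathbb R)$. -/

import Mathlib

namespace Soliton

/-- The maximal minor `Δ_M(J)`: the determinant of the columns of `M` indexed by `J`, taken in
increasing order. It is only ever used for `J` with as many elements as `M` has rows; the value
for other sizes is a placeholder. -/
noncomputable def minor {m : ℕ} {ι : Type*} [LinearOrder ι] (M : Matrix (Fin m) ι ℝ)
    (J : Finset ι) : ℝ :=
  if h : J.card = m then (M.submatrix id (J.orderEmbOfFin h)).det else 0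

/-- The Vandermonde matrix `K`, with rows `(1, κ_α, …, κ_α ^ (m - 1))`. -/
def vdm {ι : Type*} (κ : ι → ℝ) (m : ℕ) : Matrix ι (Fin m) ℝ :=
  Matrix.of fun α i => κ α ^ (i : ℕ)

/-- The phase `φ_α(x) = ∑_{u = 1}^d κ_α ^ u x_u`. -/
def phase {ι : Type*} {d : ℕ} (κ : ι → ℝ) (α : ι) (x : Fin d → ℝ) : ℝ :=
  ∑ u : Fin d, κ α ^ ((u : ℕ) + 1) * x u

/-- The term of the Cauchy-Binet expansion of `det (M * diag (exp φ) * K)` indexed by `J`: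
`Δ_M(J) * Δ_K(J) * exp (∑_{α ∈ J} φ_α(x))`. -/
noncomputable def cbTerm {m d : ℕ} {ι : Type*} [LinearOrder ι] (M : Matrix (Fin m) ι ℝ)
    (κ : ι → ℝ) (J : Finset ι) (x : Fin d → ℝ) : ℝ :=
  minor M J * minor (vdm κ m).transpose J * Real.exp (∑ α ∈ J, phase κ α x)

/-- The matroid `𝔊` of `A`: the `k`-subsets of columns with non-vanishing minor. -/
def bases {k n : ℕ} (A : Matrix (Fin k) (Fin n) ℝ) : Set (Finset (Fin n)) :=
  {I | I.card = k ∧ minor A I ≠ 0}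

/-- A signature (choice of signs) is a map `𝔊 → {±1}`. -/
abbrev Signature {k n : ℕ} (A : Matrix (Fin k) (Fin n) ℝ) : Type :=
  bases A → ℤˣ

open Classical in
/-- The set `𝔳` of the columns that lie in every member of `𝔊`. -/
noncomputable def core {k n : ℕ} (A : Matrix (Fin k) (Fin n) ℝ) : Finset (Fin n) :=
  Finset.univ.filter fun α => ∀ I ∈ bases A, α ∈ I

open Classical in
/-- The term indexed by `I` of the expansion on which the signature `S` has acted. The original
term is `0` when `I` is not in `𝔊`, and it stays `0`. -/
noncomputable def signedTerm {k n d : ℕ} (A : Matrix (Fin k) (Fin n) ℝ) (κ : Fin n → ℝ)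
    (S : Signature A) (I : Finset (Fin n)) (x : Fin d → ℝ) : ℝ :=
  if h : I ∈ bases A then ((S ⟨I, h⟩ : ℤ) : ℝ) * cbTerm A κ I x else 0

/-- `S` is determinantal: after a common non-vanishing factor `c(x)`, the terms of the signed
expansion are those of the Cauchy-Binet expansion of some matrix `a'` with `k - #𝔳` rows, columns
indexed by `[n] \ 𝔳`, and parameters `κ'_α`, `α ∈ [n] \ 𝔳`. The terms of the latter are indexed
by `I \ 𝔳`, where `I` runs through the `k`-subsets of `[n]` that contain `𝔳`; those with `I` in
`𝔊` reproduce the signed terms and those with `I` not in `𝔊` vanish. -/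
def IsDeterminantal {k n : ℕ} (d : ℕ) (A : Matrix (Fin k) (Fin n) ℝ) (κ : Fin n → ℝ)
    (S : Signature A) : Prop :=
  ∃ (κ' : {α : Fin n // α ∉ core A} → ℝ)
    (a' : Matrix (Fin (k - (core A).card)) {α : Fin n // α ∉ core A} ℝ)
    (c : (Fin d → ℝ) → ℝ),
    (∀ x, c x ≠ 0) ∧
    ∀ I : Finset (Fin n), I.card = k → core A ⊆ I → ∀ x : Fin d → ℝ,
      cbTerm a' κ' (I.subtype fun α => α ∉ core A) x = c x * signedTerm A κ S I x

/-- `S` is induced by signs `ρ` of the rows and `χ` of the columns of `A`, up to the action of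
`GL_k`: the minors of a matrix in the `GL_k`-orbit of `diag ρ * A * diag χ` are the minors of `A`
multiplied by the signs `S`. -/
def IsInducedByRowColumnSigns {k n : ℕ} (A : Matrix (Fin k) (Fin n) ℝ) (S : Signature A) : Prop :=
  ∃ (ρ : Fin k → ℤˣ) (χ : Fin n → ℤˣ) (G : GL (Fin k) ℝ), ∀ I : bases A,
    minor ((G : Matrix (Fin k) (Fin k) ℝ) *
        (Matrix.diagonal (fun i => ((ρ i : ℤ) : ℝ)) * A *
          Matrix.diagonal (fun α => ((χ α : ℤ) : ℝ)))) I.1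
      = ((S I : ℤ) : ℝ) * minor A I.1

end Soliton

namespace Soliton

open Matrix

/-! Signs of rows and columns multiply the minor at `I` by a constant times the product of the
column signs over `I`. Such a signature is determinantal: contract the coloops, using
`exists_contraction`, and scale the remaining columns by their signs. What does not depend on `I`
goes into the common factor.

For the converse, compare exponents at two bases that differ by exchanging a column `α` for `β`.
This gives the differences of the first and second powers of the two parameters, which forces `κ'`
to equal `κ` on every non-coloop lying in some base (`parameter_eq`). The Vandermonde factors on
bases then cancel. Once the columns in no base are set to zero, the maximal minors of `a'` equal
those of the contraction up to sign and a common factor.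

The heart is `exists_column_signs`: such agreement is always caused by column signs and a constant.
Normalising both matrices to the identity on one base turns all minors into maximal ones, so all
minors agree in absolute value. A matrix is determined up to row and column signs by these absolute
values (`SameAbsMinors.exists_signs`). This is proved column by column: on a shortest path joining
two rows that meet the new column, one determinant has exactly two terms, so their relative sign is
fixed. -/

/-- A square matrix whose columns other than the last are supported on the diagonal and the
subdiagonal, and whose last column vanishes off its first and last entries. -/
theorem det_subdiagonal_lastCol {m : ℕ} (N : Matrix (Fin (m + 2)) (Fin (m + 2)) ℝ)
    (hlast : ∀ i, i ≠ 0 → i ≠ Fin.last (m + 1) → N i (Fin.last (m + 1)) = 0) :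
    N.det = (-1) ^ (m + 1) * N 0 (Fin.last (m + 1)) * (N.submatrix Fin.succ Fin.castSucc).det
      + N (Fin.last (m + 1)) (Fin.last (m + 1)) *
        (N.submatrix Fin.castSucc Fin.castSucc).det := by
  rw [Matrix.det_succ_column N (Fin.last (m + 1)),
    Fintype.sum_eq_add 0 (Fin.last (m + 1)) (by simp [Fin.ext_iff])]
  · have h0 : (Fin.succAbove (0 : Fin (m + 2))) = Fin.succ := by ext i; simp
    have h1 : (Fin.succAbove (Fin.last (m + 1))) = Fin.castSucc := by ext i; simp
    rw [h0, h1]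
    have h2 : ((-1 : ℝ) ^ ((Fin.last (m + 1) : ℕ) + (Fin.last (m + 1) : ℕ))) = 1 :=
      Even.neg_one_pow ⟨_, rfl⟩
    rw [h2]
    simp
  · rintro i ⟨hi0, hi1⟩
    simp [hlast i hi0 hi1]

/-- If exactly one of the two terms changed sign, comparing squares would make the cross term `p * u
* (q * v)` vanish. -/
theorem eq_of_abs_add_eq {p q u v u' v' : ℝ} (hp : p ≠ 0) (hq : q ≠ 0) (hu : u ≠ 0) (hv : v ≠ 0)
    (huu : |u'| = |u|) (hvv : |v'| = |v|) (h : |u' * p + v' * q| = |u * p + v * q|) :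
    u' * v = u * v' := by
  have hpu : p * u ≠ 0 := mul_ne_zero hp hu
  have hqv : q * v ≠ 0 := mul_ne_zero hq hv
  have hm : (p * u) * (q * v) ≠ 0 := mul_ne_zero hpu hqv
  have key := (sq_eq_sq_iff_abs_eq_abs _ _).2 h
  rcases abs_eq_abs.1 huu with rfl | rfl <;> rcases abs_eq_abs.1 hvv with rfl | rfl
  · ring
  · exact absurd (by nlinarith : (p * u') * (q * v) = 0) hm
  · exact absurd (by nlinarith : (p * u) * (q * v') = 0) hm
  · ring

theorem abs_unit_cast (u : ℤˣ) : |((u : ℤ) : ℝ)| = 1 := by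
  rcases Int.units_eq_one_or u with rfl | rfl <;> simp

theorem unit_cast_mul_self (u : ℤˣ) : ((u : ℤ) : ℝ) * ((u : ℤ) : ℝ) = 1 := by
  rcases Int.units_eq_one_or u with rfl | rfl <;> simp

/-! ### Matrices with minors of equal absolute value. -/

section Signing

variable {R C : Type*} (a b : Matrix R C ℝ)

/-- Row `r 0` and row `r m` are joined by the alternating path through rows `r l` and columns
`col l ∈ s`. -/
def IsPath (s : Finset C) (m : ℕ) (r : ℕ → R) (col : ℕ → C) : Prop :=
  ∀ l < m, col l ∈ s ∧ a (r l) (col l) ≠ 0 ∧ a (r (l + 1)) (col l) ≠ 0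

/-- All square submatrices of `a` and `b` have determinants of equal absolute value. -/
def SameAbsMinors : Prop :=
  ∀ (m : ℕ) (f : Fin m → R) (g : Fin m → C),
    |(b.submatrix f g).det| = |(a.submatrix f g).det|

variable {a b}

theorem SameAbsMinors.abs_apply (h : SameAbsMinors a b) (i : R) (j : C) : |b i j| = |a i j| := by
  simpa using h 1 (fun _ => i) (fun _ => j)

/-- Column `col l` leads directly to a row `t` steps further on, so those `t` steps can be dropped.
-/
theorem IsPath.shortcut_right {s : Finset C} {m : ℕ} {r : ℕ → R} {col : ℕ → C}
    (hp : IsPath a s m r col) {l t : ℕ} (hlt : l + 1 + t ≤ m)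
    (hne : a (r (l + 1 + t)) (col l) ≠ 0) :
    ∃ r' col', IsPath a s (m - t) r' col' ∧ r' 0 = r 0 ∧ r' (m - t) = r m := by
  refine ⟨fun y => if y ≤ l then r y else r (y + t), fun y => if y ≤ l then col y else col (y + t),
    ?_, by simp, ?_⟩
  · intro y hy
    rcases lt_trichotomy y l with h | h | h
    · have h1 := hp y (by omega)
      simpa [h.le, Nat.succ_le_of_lt h] using h1
    · subst h
      have h1 := hp y (by omega)
      simpa using ⟨h1.1, h1.2.1, hne⟩
    · have h1 := hp (y + t) (by omega)
      have e : y + 1 + t = y + t + 1 := by omega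
      simpa [not_le.2 h, not_le.2 (Nat.lt_succ_of_lt h), e] using h1
  · have h1 : ¬ m - t ≤ l := by omega
    have h2 : m - t + t = m := by omega
    simp only [h1, if_false, h2]

/-- Row `r x` can leave directly through the later column `col (x + t)`, which again drops `t`
steps. -/
theorem IsPath.shortcut_left {s : Finset C} {m : ℕ} {r : ℕ → R} {col : ℕ → C}
    (hp : IsPath a s m r col) {x t : ℕ} (hlt : x + t < m)
    (hne : a (r x) (col (x + t)) ≠ 0) :
    ∃ r' col', IsPath a s (m - t) r' col' ∧ r' 0 = r 0 ∧ r' (m - t) = r m := by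
  refine ⟨fun y => if y ≤ x then r y else r (y + t), fun y => if y < x then col y else col (y + t),
    ?_, by simp, ?_⟩
  · intro y hy
    rcases lt_trichotomy y x with h | h | h
    · have h1 := hp y (by omega)
      simpa [h.le, h, Nat.succ_le_of_lt h] using h1
    · subst h
      have h1 := hp (y + t) (by omega)
      have e : y + 1 + t = y + t + 1 := by omega
      simpa [e] using ⟨h1.1, hne, h1.2.2⟩
    · have h1 := hp (y + t) (by omega)
      have e : y + 1 + t = y + t + 1 := by omega
      simpa [not_le.2 h, not_lt.2 h.le, not_le.2 (Nat.lt_succ_of_lt h), e] using h1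
  · have h1 : ¬ m - t ≤ x := by omega
    have h2 : m - t + t = m := by omega
    simp only [h1, if_false, h2]

/-- If `a` and `b` agree on the columns in `s`, the entries of a further column `c` change by the
same sign in any two rows that are joined by a path. -/
theorem SameAbsMinors.path_ratio (h : SameAbsMinors a b) {s : Finset C} {c : C}
    (hs : ∀ i, ∀ j ∈ s, b i j = a i j) (m : ℕ) :
    ∀ (r : ℕ → R) (col : ℕ → C), IsPath a s m r col → a (r 0) c ≠ 0 → a (r m) c ≠ 0 →
      b (r 0) c * a (r m) c = a (r 0) c * b (r m) c := by
  induction m using Nat.strong_induction_on with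
  | _ m ih =>
  intro r col hp h0 hm
  have short : ∀ t, 0 < t → t ≤ m →
      (∃ r' col', IsPath a s (m - t) r' col' ∧ r' 0 = r 0 ∧ r' (m - t) = r m) →
      b (r 0) c * a (r m) c = a (r 0) c * b (r m) c := by
    rintro t ht htm ⟨r', col', hp', e0, em⟩
    have := ih (m - t) (by omega) r' col' hp' (by rwa [e0]) (by rwa [em])
    rwa [e0, em] at this
  rcases m with _ | m
  · ring
  by_cases hR : ∃ l t, 0 < t ∧ l + 1 + t ≤ m + 1 ∧ a (r (l + 1 + t)) (col l) ≠ 0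
  · obtain ⟨l, t, ht, hlt, hne⟩ := hR
    exact short t ht (by omega) (hp.shortcut_right hlt hne)
  by_cases hL : ∃ x t, 0 < t ∧ x + t < m + 1 ∧ a (r x) (col (x + t)) ≠ 0
  · obtain ⟨x, t, ht, hlt, hne⟩ := hL
    exact short t ht (by omega) (hp.shortcut_left hlt hne)
  -- An interior row that meets `c` splits the path into two shorter ones, and their sign ratios
  -- multiply.
  by_cases hI : ∃ x, 0 < x ∧ x < m + 1 ∧ a (r x) c ≠ 0
  · obtain ⟨x, hx0, hxm, hx⟩ := hI
    have h1 := ih x hxm r col (fun l hl => hp l (by omega)) h0 hx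
    have h2 := ih (m + 1 - x) (by omega) (fun y => r (y + x)) (fun y => col (y + x))
      (fun l hl => by
        have := hp (l + x) (by omega)
        have e : l + x + 1 = l + 1 + x := by omega
        simpa [e] using this) (by simpa using hx)
        (by have e : m + 1 - x + x = m + 1 := by omega
            simpa [e] using hm)
    have e : m + 1 - x + x = m + 1 := by omega
    simp only [zero_add, e] at h2
    apply mul_left_cancel₀ hx
    linear_combination a (r (m + 1)) c * h1 + a (r 0) c * h2
  -- The path now has no chord and meets `c` only at its ends. With `c` as last column, its
  -- submatrix has the bidiagonal shape of `det_subdiagonal_lastCol`; both cofactors are triangular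
  -- with nonzero diagonal and are common to `a` and `b`.
  push Not at hR hL hI
  let f : Fin (m + 2) → R := fun i => r i
  let g : Fin (m + 2) → C := Fin.lastCases c (fun j => col j)
  have gl : g (Fin.last (m + 1)) = c := by simp [g]
  have gc : ∀ j : Fin (m + 1), g j.castSucc = col j := by intro j; simp [g]
  have hlast : ∀ i, i ≠ 0 → i ≠ Fin.last (m + 1) → a (f i) c = 0 := by
    intro i hi hi'
    refine hI i (Nat.pos_of_ne_zero fun e => hi (Fin.ext e)) ?_
    exact lt_of_le_of_ne (Nat.lt_succ_iff.1 i.2) fun e => hi' (Fin.ext e)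
  have hlast' : ∀ i, i ≠ 0 → i ≠ Fin.last (m + 1) → b (f i) c = 0 := by
    intro i hi hi'
    have := h.abs_apply (f i) c
    rwa [hlast i hi hi', abs_zero, abs_eq_zero] at this
  have ea := det_subdiagonal_lastCol (a.submatrix f g)
    (by simpa [gl] using hlast)
  have eb := det_subdiagonal_lastCol (b.submatrix f g)
    (by simpa [gl] using hlast')
  have hsub : ∀ k : Fin (m + 1) → Fin (m + 2),
      (b.submatrix f g).submatrix k Fin.castSucc = (a.submatrix f g).submatrix k Fin.castSucc := by
    intro k
    ext i j
    simp only [submatrix_apply, gc]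
    exact hs _ _ (hp j j.2).1
  rw [hsub, hsub] at eb
  have hP : ((a.submatrix f g).submatrix Fin.succ Fin.castSucc).det ≠ 0 := by
    rw [Matrix.det_of_isUpperTriangular]
    · refine Finset.prod_ne_zero_iff.2 fun i _ => ?_
      simpa [gc, f] using (hp i i.2).2.2
    · intro i j hij
      have hij' : (j : ℕ) < i := hij
      have := hR j (i - j) (by omega) (by omega)
      have e : (j : ℕ) + 1 + (i - j) = i + 1 := by omega
      simpa [gc, f, e] using this
  have hQ : ((a.submatrix f g).submatrix Fin.castSucc Fin.castSucc).det ≠ 0 := by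
    rw [Matrix.det_of_isLowerTriangular]
    · refine Finset.prod_ne_zero_iff.2 fun i _ => ?_
      simpa [gc, f] using (hp i i.2).2.1
    · intro i j hij
      have hij' : (i : ℕ) < j := hij
      have := hL i (j - i) (by omega) (by omega)
      have e : (i : ℕ) + (j - i) = j := by omega
      simpa [gc, f, e] using this
  have habs := h (m + 2) f g
  rw [ea, eb] at habs
  simp only [submatrix_apply, gl] at habs
  have f0 : f 0 = r 0 := rfl
  have fl : f (Fin.last (m + 1)) = r (m + 1) := by simp [f]
  rw [f0, fl] at habs
  refine eq_of_abs_add_eq (p := (-1) ^ (m + 1) *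
    ((a.submatrix f g).submatrix Fin.succ Fin.castSucc).det)
    (mul_ne_zero (by simp) hP) hQ h0 hm (h.abs_apply _ _) (h.abs_apply _ _) ?_
  convert habs using 2 <;> ring

theorem exists_unit_mul_of_abs_eq {x y : ℝ} (h : |y| = |x|) : ∃ t : ℤˣ, y = ((t : ℤ) : ℝ) * x := by
  rcases abs_eq_abs.1 h with h | h
  · exact ⟨1, by simpa using h⟩
  · exact ⟨-1, by simpa using h⟩

theorem SameAbsMinors.exists_signs_insert [DecidableEq C] (h : SameAbsMinors a b) {s : Finset C}
    {c : C} (hc : c ∉ s) (hs : ∀ i, ∀ j ∈ s, b i j = a i j) :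
    ∃ (ε : R → ℤˣ) (η : C → ℤˣ), ∀ i, ∀ j ∈ insert c s,
      b i j = ((ε i : ℤ) : ℝ) * ((η j : ℤ) : ℝ) * a i j := by
  classical
  have ht := fun i => exists_unit_mul_of_abs_eq (h.abs_apply i c)
  choose t ht using ht
  let Adj : R → R → Prop := fun i j => ∃ l ∈ s, a i l ≠ 0 ∧ a j l ≠ 0
  have hsymm : ∀ i j, Adj i j → Adj j i := fun i j ⟨l, hl, h1, h2⟩ => ⟨l, hl, h2, h1⟩
  have hpath : ∀ i j, Relation.ReflTransGen Adj i j →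
      ∃ m r col, IsPath a s m r col ∧ r 0 = i ∧ r m = j := by
    intro i j hij
    induction hij with
    | refl => exact ⟨0, fun _ => i, fun _ => c, fun l hl => absurd hl (by omega), rfl, rfl⟩
    | @tail j j' _ hjj' ih =>
      obtain ⟨m, r, col, hp, h0, hm⟩ := ih
      obtain ⟨l, hl, h1, h2⟩ := hjj'
      refine ⟨m + 1, fun y => if y ≤ m then r y else j', fun y => if y < m then col y else l,
        ?_, by simpa using h0, by simp⟩
      intro y hy
      rcases Nat.lt_or_ge y m with hy' | hy'
      · have := hp y hy'
        simpa [hy', hy'.le, Nat.succ_le_of_lt hy'] using this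
      · obtain rfl : y = m := by omega
        simpa [hm] using ⟨hl, h1, h2⟩
  have heq : ∀ i j, Relation.ReflTransGen Adj i j → a i c ≠ 0 → a j c ≠ 0 → t i = t j := by
    intro i j hij hi hj
    obtain ⟨m, r, col, hp, rfl, rfl⟩ := hpath i j hij
    have h1 := h.path_ratio hs m r col hp hi hj
    rw [ht, ht (r m)] at h1
    have h2 : ((t (r 0) : ℤ) : ℝ) = ((t (r m) : ℤ) : ℝ) := by
      apply mul_right_cancel₀ (mul_ne_zero hi hj)
      linear_combination h1
    exact Units.ext (by exact_mod_cast h2)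
  -- The rows of one component that meet `c` all carry the same sign there; `ε` spreads it over the
  -- component.
  let ε : R → ℤˣ := fun i =>
    if h : ∃ j, Relation.ReflTransGen Adj i j ∧ a j c ≠ 0 then t h.choose else 1
  have hε : ∀ i j, Relation.ReflTransGen Adj i j → a j c ≠ 0 → ε i = t j := by
    intro i j hij hj
    have hex : ∃ j, Relation.ReflTransGen Adj i j ∧ a j c ≠ 0 := ⟨j, hij, hj⟩
    have : ε i = t hex.choose := dif_pos hex
    rw [this]
    refine heq _ _ ?_ hex.choose_spec.2 hj
    have : Std.Symm Adj := ⟨hsymm⟩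
    exact (Std.Symm.symm _ _ hex.choose_spec.1).trans hij
  have hadj : ∀ i i', Adj i i' → ε i = ε i' := by
    intro i i' hii'
    by_cases hex : ∃ j, Relation.ReflTransGen Adj i j ∧ a j c ≠ 0
    · obtain ⟨j, hj, hjc⟩ := hex
      rw [hε i j hj hjc, hε i' j (.head (hsymm _ _ hii') hj) hjc]
    · have hex' : ¬ ∃ j, Relation.ReflTransGen Adj i' j ∧ a j c ≠ 0 :=
        fun ⟨j, hj, hjc⟩ => hex ⟨j, .head hii' hj, hjc⟩
      simp only [ε, hex, hex', dif_neg, not_false_eq_true]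
  -- The rows meeting a column of `s` lie in one component, so giving the column their sign cancels
  -- `ε` and leaves its entries unchanged.
  let η : C → ℤˣ := fun l => if h : l ∈ s ∧ ∃ i, a i l ≠ 0 then ε h.2.choose else 1
  refine ⟨ε, η, fun i j hj => ?_⟩
  rcases Finset.mem_insert.1 hj with rfl | hj
  · have h1 : η j = 1 := dif_neg fun h => hc h.1
    rw [h1]
    by_cases h0 : a i j = 0
    · rw [ht i, h0]; simp
    · rw [hε i i .refl h0, ht i]; simp
  · rw [hs i j hj]
    by_cases h0 : a i j = 0
    · simp [h0]
    · have hex : j ∈ s ∧ ∃ i, a i j ≠ 0 := ⟨hj, i, h0⟩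
      have h1 : η j = ε i := (dif_pos hex).trans (hadj _ _ ⟨j, hj, hex.2.choose_spec, h0⟩)
      rw [h1]
      rw [unit_cast_mul_self, one_mul]

theorem SameAbsMinors.scale (h : SameAbsMinors a b) (ε : R → ℤˣ) (η : C → ℤˣ) :
    SameAbsMinors a (Matrix.of fun i j => ((ε i : ℤ) : ℝ) * ((η j : ℤ) : ℝ) * b i j) := by
  intro m f g
  have e : (Matrix.of fun i j => ((ε i : ℤ) : ℝ) * ((η j : ℤ) : ℝ) * b i j).submatrix f g =
      diagonal (fun i => ((ε (f i) : ℤ) : ℝ)) * b.submatrix f g *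
        diagonal (fun j => ((η (g j) : ℤ) : ℝ)) := by
    ext i j
    simp only [submatrix_apply, of_apply, mul_diagonal, diagonal_mul]
    ring
  rw [e, det_mul, det_mul, det_diagonal, det_diagonal, abs_mul, abs_mul, Finset.abs_prod,
    Finset.abs_prod, h m f g]
  simp [abs_unit_cast]

/-- A real matrix is determined by the absolute values of its minors, up to signs of the rows and
columns. -/
theorem SameAbsMinors.exists_signs [Fintype C] (h : SameAbsMinors a b) :
    ∃ (ε : R → ℤˣ) (η : C → ℤˣ), ∀ i j,
      b i j = ((ε i : ℤ) : ℝ) * ((η j : ℤ) : ℝ) * a i j := by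
  classical
  suffices H : ∀ s : Finset C, ∃ (ε : R → ℤˣ) (η : C → ℤˣ), ∀ i, ∀ j ∈ s,
      b i j = ((ε i : ℤ) : ℝ) * ((η j : ℤ) : ℝ) * a i j by
    obtain ⟨ε, η, H⟩ := H Finset.univ
    exact ⟨ε, η, fun i j => H i j (Finset.mem_univ j)⟩
  intro s
  induction s using Finset.induction_on with
  | empty => exact ⟨1, 1, by simp⟩
  | insert c s hc ih =>
    obtain ⟨ε, η, hs⟩ := ih
    -- Undoing the signs found so far makes the two matrices agree on `s`.
    obtain ⟨ε', η', hs'⟩ := (h.scale ε η).exists_signs_insert hc (fun i j hj => by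
      rw [of_apply, hs i j hj]
      linear_combination (((η j : ℤ) : ℝ) * ((η j : ℤ) : ℝ) * a i j) * unit_cast_mul_self (ε i)
        + a i j * unit_cast_mul_self (η j))
    refine ⟨ε * ε', η * η', fun i j hj => ?_⟩
    have := hs' i j hj
    rw [of_apply] at this
    simp only [Pi.mul_apply, Units.val_mul, Int.cast_mul]
    linear_combination (((ε i : ℤ) : ℝ) * ((η j : ℤ) : ℝ)) * this
      - (((η j : ℤ) : ℝ) * ((η j : ℤ) : ℝ) * b i j) * unit_cast_mul_self (ε i)
        - b i j * unit_cast_mul_self (η j)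

end Signing

/-! ### Maximal minors, enumerations of columns, and recovery of column signs. -/

section Enumerations

variable {m : ℕ} {ι : Type*}

theorem injective_of_det_submatrix_ne_zero {M : Matrix (Fin m) ι ℝ} {e : Fin m → ι}
    (h : (M.submatrix id e).det ≠ 0) : Function.Injective e := by
  intro i j hij
  by_contra hne
  exact h (det_zero_of_column_eq hne fun x => by simp [hij])

theorem det_mul_submatrix (G : Matrix (Fin m) (Fin m) ℝ) (M : Matrix (Fin m) ι ℝ)
    (e : Fin m → ι) : ((G * M).submatrix id e).det = G.det * (M.submatrix id e).det := by
  rw [← det_mul]; rfl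

/-- If the columns `e₀` of `M` form the identity matrix, every minor of `M` is a maximal one. -/
theorem exists_extend_submatrix (e₀ : Fin m → ι) {q : ℕ} {f : Fin q → Fin m}
    (hf : Function.Injective f) (g : Fin q → ι) :
    ∃ e : Fin m → ι, ∀ M : Matrix (Fin m) ι ℝ,
      (∀ i j, M i (e₀ j) = (1 : Matrix (Fin m) (Fin m) ℝ) i j) →
      (M.submatrix id e).det = (M.submatrix f g).det := by
  classical
  -- The rows missed by `f` receive their own unit columns, so the determinant is block triangular
  -- with an identity block. Columns stay in the positions of their rows, so no sign appears.
  obtain ⟨e, hef, he⟩ : ∃ e : Fin m → ι, (∀ x, e (f x) = g x) ∧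
      ∀ i, (¬ ∃ x, f x = i) → e i = e₀ i :=
    ⟨Function.extend f g e₀, fun x => hf.extend_apply _ _ x,
      fun i hi => Function.extend_apply' _ _ i hi⟩
  let ψ : Fin q ≃ {i // ∃ x, f x = i} := Equiv.ofInjective f hf
  refine ⟨e, fun M hM => ?_⟩
  rw [twoBlockTriangular_det' (M.submatrix id e) (fun i => ∃ x, f x = i)]
  · have h2 : (toSquareBlockProp (M.submatrix id e) fun i => ¬ ∃ x, f x = i) = 1 := by
      ext i j
      change M i (e j) = _
      rw [he j j.2, hM]
      simp [one_apply, Subtype.ext_iff]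
    have h3 : (toSquareBlockProp (M.submatrix id e) fun i => ∃ x, f x = i).submatrix ψ ψ =
        M.submatrix f g := by
      ext i j
      change M (f i) (e (f j)) = _
      rw [hef]
      rfl
    rw [h2, det_one, mul_one, ← h3, det_submatrix_equiv_self]
  · intro i hi j hj
    rw [submatrix_apply, he j hj, hM, id]
    exact one_apply_ne fun hij => hj (hij ▸ hi)

/-- Cramer's rule. A nonzero coordinate of column `β` therefore means that `β` can replace `e i` in
the base. -/
theorem det_submatrix_update {M : Matrix (Fin m) ι ℝ} {e : Fin m → ι}
    (h : (M.submatrix id e).det ≠ 0) (i : Fin m) (β : ι) :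
    (M.submatrix id (Function.update e i β)).det =
      (M.submatrix id e).det * ((M.submatrix id e)⁻¹ * M) i β := by
  have hu : IsUnit (M.submatrix id e).det := isUnit_iff_ne_zero.2 h
  have e1 : M.submatrix id (Function.update e i β) =
      (M.submatrix id e) * (1 : Matrix (Fin m) (Fin m) ℝ).updateCol i
        (fun x => ((M.submatrix id e)⁻¹ * M) x β) := by
    ext x j
    by_cases hj : j = i
    · subst hj
      have : ((M.submatrix id e) * ((M.submatrix id e)⁻¹ * M)) x β = M x β := by
        rw [mul_nonsing_inv_cancel_left _ _ hu]
      simpa [mul_apply] using this.symm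
    · have : ((M.submatrix id e) * (1 : Matrix (Fin m) (Fin m) ℝ)) x j = M x (e j) := by simp
      simpa [mul_apply, hj, Matrix.updateCol_apply] using this.symm
  rw [e1, det_mul, ← cramer_apply, cramer_one]
  rfl

variable [LinearOrder ι]

theorem minor_of_card (M : Matrix (Fin m) ι ℝ) {J : Finset ι} (h : J.card = m) :
    minor M J = (M.submatrix id (J.orderEmbOfFin h)).det :=
  dif_pos h

/-- The determinant of columns enumerated in some order is the minor up to the sign of the
enumeration. -/
theorem exists_sign_minor {J : Finset ι} (h : J.card = m) {e : Fin m → ι}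
    (he : Function.Injective e) (hJ : ∀ i, e i ∈ J) :
    ∃ s : ℤˣ, ∀ M : Matrix (Fin m) ι ℝ, (M.submatrix id e).det = ((s : ℤ) : ℝ) * minor M J := by
  let p : Fin m → Fin m := fun i => (J.orderIsoOfFin h).symm ⟨e i, hJ i⟩
  have hp : Function.Injective p := fun i j hij => by
    simpa [p, he.eq_iff] using hij
  let π : Equiv.Perm (Fin m) := Equiv.ofBijective p (Finite.injective_iff_bijective.1 hp)
  have hπ : e = J.orderEmbOfFin h ∘ π := by
    funext i
    change e i = ((J.orderIsoOfFin h) ((J.orderIsoOfFin h).symm ⟨e i, hJ i⟩) : ι)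
    simp
  refine ⟨Equiv.Perm.sign π, fun M => ?_⟩
  rw [minor_of_card M h, ← Matrix.det_permute', submatrix_submatrix, hπ]
  rfl

theorem exists_sign_minor_image {e : Fin m → ι} (he : Function.Injective e) :
    (Finset.univ.image e).card = m ∧ ∃ s : ℤˣ, ∀ M : Matrix (Fin m) ι ℝ,
      (M.submatrix id e).det = ((s : ℤ) : ℝ) * minor M (Finset.univ.image e) := by
  have h : (Finset.univ.image e).card = m := by simp [Finset.card_image_of_injective _ he]
  exact ⟨h, exists_sign_minor h he (by simp)⟩

theorem minor_image_ne_zero {M : Matrix (Fin m) ι ℝ} {e : Fin m → ι}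
    (h : (M.submatrix id e).det ≠ 0) :
    (Finset.univ.image e).card = m ∧ minor M (Finset.univ.image e) ≠ 0 := by
  obtain ⟨hc, s, hs⟩ := exists_sign_minor_image (injective_of_det_submatrix_ne_zero h)
  exact ⟨hc, fun h0 => h (by rw [hs, h0, mul_zero])⟩

theorem minor_mul_left (G : Matrix (Fin m) (Fin m) ℝ) (M : Matrix (Fin m) ι ℝ) (J : Finset ι) :
    minor (G * M) J = G.det * minor M J := by
  unfold minor
  split_ifs with h
  · rw [← det_mul]; rfl
  · simp

theorem prod_orderEmbOfFin (f : ι → ℝ) {J : Finset ι} (h : J.card = m) :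
    ∏ i, f (J.orderEmbOfFin h i) = ∏ α ∈ J, f α := by
  rw [← Finset.prod_coe_sort J f]
  exact Fintype.prod_equiv (J.orderIsoOfFin h).toEquiv _ _ fun i => rfl

theorem minor_mul_diagonal [Fintype ι] [DecidableEq ι] (M : Matrix (Fin m) ι ℝ) (f : ι → ℝ) (J : Finset ι) :
    minor (M * diagonal f) J = (∏ α ∈ J, f α) * minor M J := by
  by_cases h : J.card = m
  · rw [minor_of_card _ h, minor_of_card _ h, ← prod_orderEmbOfFin f h, ← det_diagonal, mul_comm,
      ← det_mul]
    congr 1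
    ext i j
    simp [mul_diagonal]
  · simp [minor, h]

theorem minor_congr {M N : Matrix (Fin m) ι ℝ} {J : Finset ι}
    (h : ∀ i, ∀ α ∈ J, M i α = N i α) : minor M J = minor N J := by
  unfold minor
  split_ifs with hJ
  · congr 1
    ext i j
    exact h _ _ (J.orderEmbOfFin_mem hJ j)
  · rfl

theorem minor_eq_zero_of_column {M : Matrix (Fin m) ι ℝ} {J : Finset ι} {α : ι} (hα : α ∈ J)
    (h : ∀ i, M i α = 0) : minor M J = 0 := by
  by_cases hJ : J.card = m
  · rw [minor_of_card _ hJ]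
    obtain ⟨j, hj⟩ : α ∈ Set.range (J.orderEmbOfFin hJ) := by simpa using hα
    exact det_eq_zero_of_column_eq_zero j fun i => by simp [hj, h]
  · simp [minor, hJ]

theorem minor_vdm_ne_zero {κ : ι → ℝ} {J : Finset ι} (hJ : J.card = m)
    (hκ : Set.InjOn κ J) : minor (vdm κ m).transpose J ≠ 0 := by
  rw [minor_of_card _ hJ]
  have e : (vdm κ m).transpose.submatrix id (J.orderEmbOfFin hJ) =
      (vandermonde (κ ∘ J.orderEmbOfFin hJ)).transpose := rfl
  rw [e, det_transpose, det_vandermonde_ne_zero_iff]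
  intro i j hij
  exact (J.orderEmbOfFin hJ).injective
    (hκ (J.orderEmbOfFin_mem hJ i) (J.orderEmbOfFin_mem hJ j) hij)

/-- Two matrices whose maximal minors agree up to sign and a common factor have minors that differ
by signs of the columns and a common factor. -/
theorem exists_column_signs [Fintype ι] {A B : Matrix (Fin m) ι ℝ} {D : ℝ} (hD : D ≠ 0)
    (h : ∀ J : Finset ι, J.card = m → |minor B J| = |D| * |minor A J|)
    (hA : ∃ J : Finset ι, J.card = m ∧ minor A J ≠ 0) :
    ∃ (c : ℝ) (η : ι → ℤˣ), ∀ J : Finset ι, J.card = m →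
      minor B J = c * (∏ α ∈ J, ((η α : ℤ) : ℝ)) * minor A J := by
  classical
  have hdet : ∀ e : Fin m → ι, |(B.submatrix id e).det| = |D| * |(A.submatrix id e).det| := by
    intro e
    by_cases he : Function.Injective e
    · obtain ⟨hc, s, hs⟩ := exists_sign_minor_image he
      rw [hs, hs, abs_mul, abs_mul, h _ hc]
      ring
    · rw [not_imp_comm.1 injective_of_det_submatrix_ne_zero he,
        not_imp_comm.1 injective_of_det_submatrix_ne_zero he]
      simp
  obtain ⟨J, hJ, hAJ⟩ := hA
  let e₀ : Fin m → ι := J.orderEmbOfFin hJ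
  have hA0 : (A.submatrix id e₀).det ≠ 0 := by rwa [minor_of_card _ hJ] at hAJ
  have hB0 : (B.submatrix id e₀).det ≠ 0 := by
    rw [← abs_ne_zero, hdet]
    exact mul_ne_zero (abs_ne_zero.2 hD) (abs_ne_zero.2 hA0)
  have huA : IsUnit (A.submatrix id e₀).det := isUnit_iff_ne_zero.2 hA0
  have huB : IsUnit (B.submatrix id e₀).det := isUnit_iff_ne_zero.2 hB0
  set a := (A.submatrix id e₀)⁻¹ * A with ha
  set b := (B.submatrix id e₀)⁻¹ * B with hb
  have hA' : A = A.submatrix id e₀ * a := (mul_nonsing_inv_cancel_left _ _ huA).symm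
  have hB' : B = B.submatrix id e₀ * b := (mul_nonsing_inv_cancel_left _ _ huB).symm
  have ha0 : ∀ i j, a i (e₀ j) = (1 : Matrix (Fin m) (Fin m) ℝ) i j := by
    intro i j
    rw [← nonsing_inv_mul _ huA]; rfl
  have hb0 : ∀ i j, b i (e₀ j) = (1 : Matrix (Fin m) (Fin m) ℝ) i j := by
    intro i j
    rw [← nonsing_inv_mul _ huB]; rfl
  -- Dividing by the relation at `e₀` removes `|D|`.
  have hab : ∀ e : Fin m → ι, |(b.submatrix id e).det| = |(a.submatrix id e).det| := by
    intro e
    have eA : (A.submatrix id e).det = (A.submatrix id e₀).det * (a.submatrix id e).det := by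
      conv_lhs => rw [hA', det_mul_submatrix]
    have eB : (B.submatrix id e).det = (B.submatrix id e₀).det * (b.submatrix id e).det := by
      conv_lhs => rw [hB', det_mul_submatrix]
    have h1 := hdet e
    rw [eA, eB, abs_mul, abs_mul, hdet e₀] at h1
    apply mul_left_cancel₀ (mul_ne_zero (abs_ne_zero.2 hD) (abs_ne_zero.2 hA0))
    rw [h1]; ring
  have hsame : SameAbsMinors a b := by
    intro q f g
    by_cases hf : Function.Injective f
    · obtain ⟨e, he⟩ := exists_extend_submatrix e₀ hf g
      rw [← he a ha0, ← he b hb0, hab]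
    · obtain ⟨x, y, hxy, hne⟩ : ∃ x y, f x = f y ∧ x ≠ y := by
        simpa [Function.Injective] using hf
      rw [det_zero_of_row_eq hne (by ext; simp [hxy]), det_zero_of_row_eq hne (by ext; simp [hxy])]
  obtain ⟨ε, η, hεη⟩ := hsame.exists_signs
  have hbd : b = diagonal (fun i => ((ε i : ℤ) : ℝ)) * a *
      diagonal (fun j => ((η j : ℤ) : ℝ)) := by
    ext i j
    rw [hεη, mul_diagonal, diagonal_mul]
    ring
  -- The row signs affect a maximal minor only through their product, so they are absorbed into the
  -- constant.
  refine ⟨(B.submatrix id e₀).det * (∏ i, ((ε i : ℤ) : ℝ)) / (A.submatrix id e₀).det, η,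
    fun J _ => ?_⟩
  have h1 : minor B J = (B.submatrix id e₀).det * ((∏ i, ((ε i : ℤ) : ℝ)) *
      ((∏ α ∈ J, ((η α : ℤ) : ℝ)) * minor a J)) := by
    conv_lhs => rw [hB', minor_mul_left, hbd, Matrix.mul_assoc, minor_mul_left, det_diagonal,
      minor_mul_diagonal]
  have h2 : minor A J = (A.submatrix id e₀).det * minor a J := by
    conv_lhs => rw [hA', minor_mul_left]
  rw [h1, h2]
  field_simp

end Enumerations

/-- Pairs of indices lie within the first block, within the second, or across; all cross pairs have
the index from `v` first. -/
theorem det_vandermonde_append {r q : ℕ} (v : Fin r → ℝ) (w : Fin q → ℝ) :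
    (vandermonde (Sum.elim v w ∘ finSumFinEquiv.symm)).det =
      (∏ i, ∏ j, (w j - v i)) * (vandermonde v).det * (vandermonde w).det := by
  have h : ∀ {m : ℕ} (u : Fin m → ℝ), (vandermonde u).det =
      ∏ i, ∏ j, if i < j then u j - u i else 1 := by
    intro m u
    rw [det_vandermonde]
    refine Finset.prod_congr rfl fun i _ => ?_
    rw [← Finset.prod_filter]
    exact Finset.prod_congr (by ext; simp) fun _ _ => rfl
  rw [h, h, h]
  simp only [Fin.prod_univ_add, Function.comp_apply, finSumFinEquiv_symm_apply_castAdd,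
    finSumFinEquiv_symm_apply_natAdd, Sum.elim_inl, Sum.elim_inr, Finset.prod_mul_distrib]
  have h1 : ∀ (i : Fin r) (j : Fin q), Fin.castAdd q i < Fin.natAdd r j := fun i j => by
    rw [Fin.lt_def, Fin.val_castAdd, Fin.val_natAdd]; omega
  have h2 : ∀ (i : Fin r) (j : Fin q), ¬ Fin.natAdd r j < Fin.castAdd q i := fun i j => by
    rw [Fin.lt_def, Fin.val_castAdd, Fin.val_natAdd]; omega
  have h3 : ∀ (i j : Fin r), Fin.castAdd q i < Fin.castAdd q j ↔ i < j := fun i j => by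
    simp only [Fin.lt_def, Fin.val_castAdd]
  have h4 : ∀ (i j : Fin q), Fin.natAdd r i < Fin.natAdd r j ↔ i < j := fun i j => by
    simp only [Fin.lt_def, Fin.val_natAdd, add_lt_add_iff_left]
  simp only [h1, h2, h3, h4, if_true, if_false, Finset.prod_const_one]
  ring

/-! ### Bases, exchange, and contraction of the coloops. -/

section Matroid

variable {k n : ℕ} {A : Matrix (Fin k) (Fin n) ℝ}

theorem mem_core {α : Fin n} : α ∈ core A ↔ ∀ I ∈ bases A, α ∈ I := by
  classical simp [core]

theorem core_subset {I : Finset (Fin n)} (hI : I ∈ bases A) : core A ⊆ I :=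
  fun _ hα => mem_core.1 hα I hI

theorem image_mem_bases {e : Fin k → Fin n} (h : (A.submatrix id e).det ≠ 0) :
    Finset.univ.image e ∈ bases A :=
  minor_image_ne_zero h

theorem bases_nonempty (hA : A.rank = k) : (bases A).Nonempty := by
  rw [rank_eq_finrank_span_cols] at hA
  obtain ⟨f, hf, -, hli⟩ := Submodule.exists_fun_fin_finrank_span_eq ℝ (Set.range A.col)
  choose e he using hf
  have hli' : LinearIndependent ℝ (A.submatrix id (e ∘ Fin.cast hA.symm)).col := by
    have : (A.submatrix id (e ∘ Fin.cast hA.symm)).col = f ∘ Fin.cast hA.symm := by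
      funext i
      exact he _
    rw [this]
    exact hli.comp _ (Fin.cast_injective _)
  exact ⟨_, image_mem_bases
    ((isUnit_iff_isUnit_det _).1 (linearIndependent_cols_iff_isUnit.1 hli')).ne_zero⟩

/-- In coordinates with respect to a basis, the row of a coloop vanishes off that coloop. -/
theorem coord_eq_zero_of_mem_core {e : Fin k → Fin n} (h : (A.submatrix id e).det ≠ 0) {i : Fin k}
    (hi : e i ∈ core A) {β : Fin n} (hβ : β ≠ e i) : ((A.submatrix id e)⁻¹ * A) i β = 0 := by
  by_contra hne
  have h1 : (A.submatrix id (Function.update e i β)).det ≠ 0 := by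
    rw [det_submatrix_update h]
    exact mul_ne_zero h hne
  have h2 := mem_core.1 hi _ (image_mem_bases h1)
  obtain ⟨j, -, hj⟩ := Finset.mem_image.1 h2
  by_cases hji : j = i
  · subst hji
    exact hβ (by simpa using hj)
  · rw [Function.update_of_ne hji] at hj
    exact hji (injective_of_det_submatrix_ne_zero h hj)

/-- Some base `J` avoids `α`. In coordinates with respect to `I`, the row of `α` cannot vanish on
all of `J`, and a column of `J` where it is nonzero is the required `β`. -/
theorem exists_exchange {α : Fin n} (hα : α ∉ core A) {I : Finset (Fin n)} (hI : I ∈ bases A)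
    (hαI : α ∈ I) : ∃ β, β ∉ I ∧ insert β (I.erase α) ∈ bases A := by
  classical
  obtain ⟨J, hJ, hαJ⟩ : ∃ J ∈ bases A, α ∉ J := by simpa [mem_core] using hα
  have hdI := hI.2
  have hdJ := hJ.2
  rw [minor_of_card _ hI.1] at hdI
  rw [minor_of_card _ hJ.1] at hdJ
  set e : Fin k → Fin n := ⇑(I.orderEmbOfFin hI.1) with he
  set g : Fin k → Fin n := ⇑(J.orderEmbOfFin hJ.1) with hg
  have hu : IsUnit (A.submatrix id e).det := isUnit_iff_ne_zero.2 hdI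
  obtain ⟨i, hi⟩ : α ∈ Set.range e := by simpa [he] using hαI
  have hinj : Function.Injective e := injective_of_det_submatrix_ne_zero hdI
  obtain ⟨j, hj⟩ : ∃ j, ((A.submatrix id e)⁻¹ * A) i (g j) ≠ 0 := by
    by_contra! hall
    have h0 : (((A.submatrix id e)⁻¹ * A).submatrix id g).det = 0 :=
      det_eq_zero_of_row_eq_zero i hall
    rw [det_mul_submatrix] at h0
    refine mul_ne_zero ?_ hdJ h0
    exact ((isUnit_nonsing_inv_det_iff).2 hu).ne_zero
  have hβα : g j ≠ α := fun h => hαJ (h ▸ J.orderEmbOfFin_mem hJ.1 j)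
  have hβI : g j ∉ I := by
    intro hmem
    obtain ⟨j', hj'⟩ : g j ∈ Set.range e := by simpa [he] using hmem
    rw [← hj'] at hj hβα
    have h1 : ((A.submatrix id e)⁻¹ * A) i (e j') = (1 : Matrix (Fin k) (Fin k) ℝ) i j' := by
      rw [← nonsing_inv_mul _ hu]; rfl
    rw [h1, one_apply_ne (fun h => hβα (by rw [← h, hi]))] at hj
    exact hj rfl
  refine ⟨g j, hβI, ?_⟩
  have h1 : (A.submatrix id (Function.update e i (g j))).det ≠ 0 := by
    rw [det_submatrix_update hdI]
    exact mul_ne_zero hdI hj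
  convert image_mem_bases h1 using 1
  ext x
  simp only [Finset.mem_insert, Finset.mem_erase, Finset.mem_image, Finset.mem_univ, true_and]
  constructor
  · rintro (rfl | ⟨hx, hxI⟩)
    · exact ⟨i, by simp⟩
    · obtain ⟨y, rfl⟩ : x ∈ Set.range e := by simpa [he] using hxI
      exact ⟨y, Function.update_of_ne (fun h => hx (by rw [h, hi])) _ _⟩
  · rintro ⟨y, rfl⟩
    by_cases hy : y = i
    · left; rw [hy]; simp
    · right
      rw [Function.update_of_ne hy]
      exact ⟨fun h => hy (hinj (h.trans hi.symm)), I.orderEmbOfFin_mem hI.1 y⟩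

theorem map_subtype_compl_core (I : Finset (Fin n)) :
    (I.subtype fun α => α ∉ core A).map (Function.Embedding.subtype _) = I \ core A := by
  rw [Finset.subtype_map]
  ext; simp

theorem card_subtype_compl_core {I : Finset (Fin n)} (hI : I.card = k) (hc : core A ⊆ I) :
    (I.subtype fun α => α ∉ core A).card = k - (core A).card := by
  rw [← Finset.card_map (Function.Embedding.subtype _), map_subtype_compl_core,
    Finset.card_sdiff_of_subset hc, hI]

theorem exists_subtype_compl_core_eq (hA : (bases A).Nonempty)
    {J : Finset {α : Fin n // α ∉ core A}} (hJ : J.card = k - (core A).card) :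
    ∃ I : Finset (Fin n), I.card = k ∧ core A ⊆ I ∧ (I.subtype fun α => α ∉ core A) = J := by
  classical
  obtain ⟨I₀, hI₀⟩ := hA
  have hle : (core A).card ≤ k := (Finset.card_le_card (core_subset hI₀)).trans_eq hI₀.1
  refine ⟨core A ∪ J.map (Function.Embedding.subtype _), ?_, Finset.subset_union_left, ?_⟩
  · rw [Finset.card_union_of_disjoint, Finset.card_map, hJ]
    · omega
    · rw [Finset.disjoint_left]
      intro α hα hα'
      obtain ⟨β, -, rfl⟩ := Finset.mem_map.1 hα'
      exact β.2 hα
  · ext ⟨α, hα⟩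
    simp [hα]

/-- Contraction of the coloops: up to a constant factor, the products of the maximal minors with
the Vandermonde determinants are those of a matrix with columns indexed by the non-coloops. -/
theorem exists_contraction (κ : Fin n → ℝ) (hA : (bases A).Nonempty) :
    ∃ (M : Matrix (Fin (k - (core A).card)) {α : Fin n // α ∉ core A} ℝ) (C : ℝ),
      ∀ I : Finset (Fin n), I.card = k → core A ⊆ I →
        minor A I * minor (vdm κ k).transpose I =
          C * (minor M (I.subtype fun α => α ∉ core A) *
            minor (vdm (fun α : {α : Fin n // α ∉ core A} => κ α) (k - (core A).card)).transpose
              (I.subtype fun α => α ∉ core A)) := by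
  classical
  obtain ⟨I₀, hI₀⟩ := hA
  have hle : (core A).card ≤ k := (Finset.card_le_card (core_subset hI₀)).trans_eq hI₀.1
  set r := k - (core A).card with hr
  have hrk : r + (core A).card = k := by omega
  let σ : Fin r ⊕ Fin (core A).card ≃ Fin k := finSumFinEquiv.trans (finCongr hrk)
  let v : Fin (core A).card → Fin n := (core A).orderEmbOfFin rfl
  have hv : ∀ i, v i ∈ core A := fun i => (core A).orderEmbOfFin_mem rfl i
  -- `E g` lists the non-coloops first and the coloops last. The sign of this reordering occurs in
  -- both the minor of `A` and the Vandermonde determinant, hence cancels in their product.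
  let E : (Fin r → {α : Fin n // α ∉ core A}) → Fin k → Fin n :=
    fun g => Sum.elim (fun i => (g i : Fin n)) v ∘ σ.symm
  have hEl : ∀ g i, E g (σ (Sum.inl i)) = g i := fun g i => by simp [E]
  have hEr : ∀ g i, E g (σ (Sum.inr i)) = v i := fun g i => by simp [E]
  let g : ∀ I : Finset (Fin n), I.card = k → core A ⊆ I → Fin r → {α : Fin n // α ∉ core A} :=
    fun I hI hc => (I.subtype fun α => α ∉ core A).orderEmbOfFin (card_subtype_compl_core hI hc)
  have hsign : ∀ I hI hc, ∃ s : ℤˣ, ∀ M : Matrix (Fin k) (Fin n) ℝ,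
      (M.submatrix id (E (g I hI hc))).det = ((s : ℤ) : ℝ) * minor M I := by
    intro I hI hc
    refine exists_sign_minor hI ?_ ?_
    · refine Function.Injective.comp ?_ σ.symm.injective
      refine Function.Injective.sumElim ?_ ((core A).orderEmbOfFin rfl).injective ?_
      · exact Subtype.val_injective.comp (Finset.orderEmbOfFin _ _).injective
      · exact fun i j hij => (g I hI hc i).2 (hij ▸ hv j)
    · intro i
      obtain ⟨x, rfl⟩ := σ.surjective i
      rcases x with i | i
      · rw [hEl]
        exact Finset.mem_subtype.1 (Finset.orderEmbOfFin_mem _ _ i)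
      · rw [hEr]
        exact hc (hv i)
  obtain ⟨s₀, hs₀⟩ := hsign I₀ hI₀.1 (core_subset hI₀)
  let e₀ := E (g I₀ hI₀.1 (core_subset hI₀))
  have hd₀ : (A.submatrix id e₀).det ≠ 0 := by
    rw [hs₀]
    exact mul_ne_zero (by rw [← abs_ne_zero, abs_unit_cast]; exact one_ne_zero) hI₀.2
  have hu : IsUnit (A.submatrix id e₀).det := isUnit_iff_ne_zero.2 hd₀
  let M := (A.submatrix id e₀)⁻¹ * A
  have hM₀ : ∀ i j, M i (e₀ j) = (1 : Matrix (Fin k) (Fin k) ℝ) i j := by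
    intro i j
    rw [← nonsing_inv_mul _ hu]; rfl
  let a : Matrix (Fin r) {α : Fin n // α ∉ core A} ℝ := M.submatrix (σ ∘ Sum.inl) Subtype.val
  have hdet : ∀ g, (A.submatrix id (E g)).det =
      (A.submatrix id e₀).det * (a.submatrix id g).det := by
    intro g
    have h1 : A = A.submatrix id e₀ * M := (mul_nonsing_inv_cancel_left _ _ hu).symm
    conv_lhs => rw [h1, det_mul_submatrix]
    congr 1
    -- Coloop columns are unit vectors and coloop rows vanish elsewhere, so the matrix is block
    -- diagonal.
    have h2 : (M.submatrix id (E g)).submatrix σ σ = fromBlocks (a.submatrix id g) 0 0 1 := by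
      ext i j
      rw [submatrix_apply, submatrix_apply, id]
      rcases j with j | j
      · rw [hEl]
        rcases i with i | i
        · rfl
        · refine coord_eq_zero_of_mem_core hd₀ ?_ ?_
          · simpa only [e₀, hEr] using hv i
          · simp only [e₀, hEr]
            exact fun h => (g j).2 (h ▸ hv i)
      · have h3 : E g (σ (Sum.inr j)) = e₀ (σ (Sum.inr j)) := by simp only [e₀, hEr]
        rw [h3, hM₀]
        rcases i with i | i <;> simp [one_apply]
    rw [← det_submatrix_equiv_self σ, h2, det_fromBlocks_zero₂₁, det_one, mul_one]
  -- The Vandermonde factors between `α` and the coloops; they become a scaling of column `α`.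
  let f : {α : Fin n // α ∉ core A} → ℝ := fun α => ∏ j, (κ (v j) - κ α)
  have hvdm : ∀ g : Fin r → {α : Fin n // α ∉ core A},
      ((vdm κ k).transpose.submatrix id (E g)).det = (∏ i, f (g i)) *
        ((vdm (fun α : {α : Fin n // α ∉ core A} => κ α) r).transpose.submatrix id g).det *
          (vandermonde (κ ∘ v)).det := by
    intro g
    have h1 : ((vdm κ k).transpose.submatrix id (E g)).submatrix (finCongr hrk) (finCongr hrk) =
        (vandermonde (Sum.elim (fun i => κ (g i)) (κ ∘ v) ∘ finSumFinEquiv.symm)).transpose := by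
      ext i j
      obtain ⟨x, rfl⟩ := finSumFinEquiv.surjective j
      rcases x with j | j
      · change κ (E g (σ (Sum.inl j))) ^ (i : ℕ) = _
        rw [hEl]
        simp [vandermonde]
      · change κ (E g (σ (Sum.inr j))) ^ (i : ℕ) = _
        rw [hEr]
        simp [vandermonde]
    rw [← det_submatrix_equiv_self (finCongr hrk), h1, det_transpose, det_vandermonde_append]
    congr 2
    exact (det_transpose _).symm
  refine ⟨a * diagonal f, (A.submatrix id e₀).det * (vandermonde (κ ∘ v)).det, fun I hI hc => ?_⟩
  obtain ⟨s, hs⟩ := hsign I hI hc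
  have h1 : minor A I * minor (vdm κ k).transpose I =
      (A.submatrix id (E (g I hI hc))).det *
        ((vdm κ k).transpose.submatrix id (E (g I hI hc))).det := by
    rw [hs, hs]
    linear_combination (-(minor A I * minor (vdm κ k).transpose I)) * unit_cast_mul_self s
  rw [h1, hdet, hvdm, minor_mul_diagonal,
    ← prod_orderEmbOfFin f (card_subtype_compl_core hI hc),
    minor_of_card a (card_subtype_compl_core hI hc),
    minor_of_card _ (card_subtype_compl_core hI hc)]
  ring

end Matroid

/-! ### Comparison of exponents. -/

theorem phase_single {ι : Type*} {d : ℕ} (κ : ι → ℝ) (α : ι) (u : Fin d) :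
    phase κ α (Pi.single u 1) = κ α ^ ((u : ℕ) + 1) := by
  simp [phase, Pi.single_apply]

theorem phase_zero {ι : Type*} {d : ℕ} (κ : ι → ℝ) (α : ι) :
    phase κ α (0 : Fin d → ℝ) = 0 := by
  simp [phase]

/-- Dividing the difference of squares by the nonzero difference recovers the sum, hence both
numbers. -/
theorem eq_of_power_sums {x y x' y' : ℝ} (hxy : x ≠ y) (h1 : x' - y' = x - y)
    (h2 : x' ^ 2 - y' ^ 2 = x ^ 2 - y ^ 2) : x' = x := by
  have h3 : (x - y) * (x' + y' - (x + y)) = 0 := by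
    rw [← sub_eq_zero] at h1 h2
    linear_combination h2 - (x' + y') * h1
  rcases mul_eq_zero.1 h3 with h | h
  · exact absurd (sub_eq_zero.1 h) hxy
  · linarith

/-- Proportional exponential terms have the same differences of exponents. -/
theorem exponent_add_eq {X : Type*} {x₀ : X} {p q p' q' : ℝ} {f g f' g' c : X → ℝ}
    (hc : ∀ x, c x ≠ 0) (hq : q ≠ 0) (hq' : q' ≠ 0)
    (h : ∀ x, p * Real.exp (f x) = c x * (q * Real.exp (g x)))
    (h' : ∀ x, p' * Real.exp (f' x) = c x * (q' * Real.exp (g' x)))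
    (hf : f x₀ = 0) (hg : g x₀ = 0) (hf' : f' x₀ = 0) (hg' : g' x₀ = 0) (x : X) :
    f x + g' x = f' x + g x := by
  -- Evaluation at `x₀` expresses `p` and `p'` through `c x₀`; cross-multiplication then eliminates
  -- `c x`.
  have h0 := h x₀
  have h0' := h' x₀
  rw [hf, hg, Real.exp_zero, mul_one, mul_one] at h0
  rw [hf', hg', Real.exp_zero, mul_one, mul_one] at h0'
  have hx := h x
  have hx' := h' x
  rw [h0] at hx
  rw [h0'] at hx'
  apply Real.exp_injective
  rw [Real.exp_add, Real.exp_add]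
  apply mul_left_cancel₀ (mul_ne_zero (mul_ne_zero (mul_ne_zero (hc x₀) hq) hq') (hc x))
  linear_combination (c x * q' * Real.exp (g' x)) * hx - (c x * q * Real.exp (g x)) * hx'

/-! ### The two implications. -/

section Main

variable {k n d : ℕ} {A : Matrix (Fin k) (Fin n) ℝ} {κ : Fin n → ℝ} {S : Signature A}

theorem signedTerm_of_mem {I : Finset (Fin n)} (hI : I ∈ bases A) (x : Fin d → ℝ) :
    signedTerm A κ S I x = ((S ⟨I, hI⟩ : ℤ) : ℝ) * cbTerm A κ I x :=
  dif_pos hI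

theorem signedTerm_of_notMem {I : Finset (Fin n)} (hI : I ∉ bases A) (x : Fin d → ℝ) :
    signedTerm A κ S I x = 0 :=
  dif_neg hI

theorem unit_cast_ne_zero (u : ℤˣ) : ((u : ℤ) : ℝ) ≠ 0 :=
  left_ne_zero_of_mul_eq_one (unit_cast_mul_self u)

/-- The parameters of a determinantal signature are the original ones, except on the loops. -/
theorem parameter_eq (hd : 2 ≤ d) (hκ : Function.Injective κ)
    {κ' : {α : Fin n // α ∉ core A} → ℝ}
    {a' : Matrix (Fin (k - (core A).card)) {α : Fin n // α ∉ core A} ℝ}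
    {c : (Fin d → ℝ) → ℝ} (hc : ∀ x, c x ≠ 0)
    (h : ∀ I : Finset (Fin n), I.card = k → core A ⊆ I → ∀ x : Fin d → ℝ,
      cbTerm a' κ' (I.subtype fun α => α ∉ core A) x = c x * signedTerm A κ S I x)
    {I : Finset (Fin n)} (hI : I ∈ bases A) (α : {α : Fin n // α ∉ core A}) (hα : (α : Fin n) ∈ I) :
    κ' α = κ α := by
  classical
  obtain ⟨β, hβ, hJ⟩ := exists_exchange α.2 hI hα
  have hβc : β ∉ core A := fun hb => hβ (core_subset hI hb)
  have term : ∀ {I : Finset (Fin n)} (hI : I ∈ bases A) (x : Fin d → ℝ),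
      minor a' (I.subtype fun α => α ∉ core A) *
          minor (vdm κ' (k - (core A).card)).transpose (I.subtype fun α => α ∉ core A) *
        Real.exp (∑ α ∈ I.subtype fun α => α ∉ core A, phase κ' α x) =
      c x * (((S ⟨I, hI⟩ : ℤ) : ℝ) * (minor A I * minor (vdm κ k).transpose I) *
        Real.exp (∑ α ∈ I, phase κ α x)) := by
    intro I hI x
    have := h I hI.1 (core_subset hI) x
    rw [signedTerm_of_mem hI] at this
    simp only [cbTerm] at this
    rw [this]
    ring
  have coeff : ∀ {I : Finset (Fin n)} (hI : I ∈ bases A),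
      ((S ⟨I, hI⟩ : ℤ) : ℝ) * (minor A I * minor (vdm κ k).transpose I) ≠ 0 := fun hI =>
    mul_ne_zero (unit_cast_ne_zero _) (mul_ne_zero hI.2 (minor_vdm_ne_zero hI.1 hκ.injOn))
  have key := fun x => exponent_add_eq (x₀ := 0) hc (coeff hI) (coeff hJ) (term hI) (term hJ)
    (by simp [phase_zero]) (by simp [phase_zero]) (by simp [phase_zero]) (by simp [phase_zero]) x
  have hsub : (insert β (I.erase α)).subtype (fun α => α ∉ core A) =
      insert ⟨β, hβc⟩ ((I.subtype fun α => α ∉ core A).erase α) := by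
    ext γ
    simp [Subtype.ext_iff]
  have hβ' : (⟨β, hβc⟩ : {α : Fin n // α ∉ core A}) ∉
      (I.subtype fun α => α ∉ core A).erase α := by
    simp [hβ]
  have hβ'' : β ∉ I.erase α := by simp [hβ]
  -- The two bases differ only in `α` and `β`, so all other phases cancel.
  have diff : ∀ x : Fin d → ℝ,
      phase κ' α x - phase κ' ⟨β, hβc⟩ x = phase κ α x - phase κ β x := by
    intro x
    have h1 := key x
    rw [hsub, Finset.sum_insert hβ', Finset.sum_insert hβ'',
      ← Finset.add_sum_erase I _ hα,
      ← Finset.add_sum_erase (I.subtype fun α => α ∉ core A) _ (Finset.mem_subtype.2 hα)] at h1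
    linarith
  have h1 := diff (Pi.single ⟨0, by omega⟩ 1)
  have h2 := diff (Pi.single ⟨1, by omega⟩ 1)
  simp only [phase_single, zero_add, pow_one, Nat.reduceAdd] at h1 h2
  exact eq_of_power_sums (fun e => hβ (by rw [← hκ e]; exact hα)) h1 h2

theorem prod_subtype_compl_core (χ : Fin n → ℝ) {I : Finset (Fin n)} (hc : core A ⊆ I) :
    ∏ α ∈ I, χ α = (∏ α ∈ core A, χ α) * ∏ α ∈ I.subtype (fun α => α ∉ core A), χ α := by
  rw [← Finset.prod_sdiff hc, mul_comm, ← map_subtype_compl_core, Finset.prod_map]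
  rfl

theorem sum_subtype_compl_core (f : Fin n → ℝ) {I : Finset (Fin n)} (hc : core A ⊆ I) :
    ∑ α ∈ I, f α = ∑ α ∈ core A, f α + ∑ α ∈ I.subtype (fun α => α ∉ core A), f α := by
  rw [← Finset.sum_sdiff hc, add_comm, ← map_subtype_compl_core, Finset.sum_map]
  rfl

/-- Signs of the rows and columns, up to `GL_k`, act on the minors by a constant and the column
signs. -/
theorem isInducedByRowColumnSigns_of_eq (hk : 0 < k) {c : ℤˣ} {χ : Fin n → ℤˣ}
    (h : ∀ I : bases A, S I = c * ∏ α ∈ I.1, χ α) : IsInducedByRowColumnSigns A S := by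
  classical
  -- The constant sign is realised by the first row alone.
  refine ⟨Pi.mulSingle ⟨0, hk⟩ c, χ, 1, fun I => ?_⟩
  have h1 : ∏ i, (((Pi.mulSingle ⟨0, hk⟩ c : Fin k → ℤˣ) i : ℤˣ) : ℤ) = c := by
    rw [← Units.coe_prod, Fintype.prod_eq_single ⟨0, hk⟩ fun i hi => Pi.mulSingle_eq_of_ne hi _,
      Pi.mulSingle_eq_same]
  rw [Units.val_one, Matrix.one_mul, Matrix.mul_assoc, minor_mul_left, det_diagonal,
    minor_mul_diagonal, h I, ← Int.cast_prod, h1]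
  simp only [Units.val_mul, Units.coe_prod, Int.cast_mul, Int.cast_prod]
  ring

theorem contraction_const_ne_zero (hA : (bases A).Nonempty) (hκ : Function.Injective κ)
    {M : Finset (Fin n) → ℝ} {C : ℝ}
    (hM : ∀ I : Finset (Fin n), I.card = k → core A ⊆ I →
      minor A I * minor (vdm κ k).transpose I = C * M I) : C ≠ 0 := by
  obtain ⟨I, hI⟩ := hA
  rintro rfl
  have h1 := hM I hI.1 (core_subset hI)
  rw [zero_mul] at h1
  exact mul_ne_zero hI.2 (minor_vdm_ne_zero hI.1 hκ.injOn) h1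

theorem IsInducedByRowColumnSigns.isDeterminantal (hκ : Function.Injective κ) (hA : (bases A).Nonempty)
    (h : IsInducedByRowColumnSigns A S) : IsDeterminantal d A κ S := by
  classical
  obtain ⟨ρ, χ, G, h⟩ := h
  obtain ⟨M, C, hM⟩ := exists_contraction κ hA
  set t : ℝ := (G : Matrix (Fin k) (Fin k) ℝ).det * ∏ i, ((ρ i : ℤ) : ℝ) with ht
  have ht0 : t ≠ 0 := mul_ne_zero ((isUnit_iff_isUnit_det _).1 G.isUnit).ne_zero
    (Finset.prod_ne_zero_iff.2 fun i _ => unit_cast_ne_zero _)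
  have hS : ∀ I (hI : I ∈ bases A), ((S ⟨I, hI⟩ : ℤ) : ℝ) = t * ∏ α ∈ I, ((χ α : ℤ) : ℝ) := by
    intro I hI
    have h1 := h ⟨I, hI⟩
    rw [Matrix.mul_assoc, minor_mul_left, minor_mul_left, minor_mul_diagonal, det_diagonal] at h1
    apply mul_right_cancel₀ hI.2
    rw [← h1, ht]
    ring
  have hC := contraction_const_ne_zero hA hκ hM
  set u : (Fin d → ℝ) → ℝ := fun x =>
    t * (∏ α ∈ core A, ((χ α : ℤ) : ℝ)) * C * Real.exp (∑ α ∈ core A, phase κ α x) with hu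
  have hu0 : ∀ x, u x ≠ 0 := fun x => mul_ne_zero (mul_ne_zero (mul_ne_zero ht0
    (Finset.prod_ne_zero_iff.2 fun i _ => unit_cast_ne_zero _)) hC) (Real.exp_ne_zero _)
  refine ⟨fun α => κ α, M * diagonal (fun α : {α : Fin n // α ∉ core A} => ((χ α : ℤ) : ℝ)), fun x => (u x)⁻¹,
    fun x => inv_ne_zero (hu0 x), fun I hI hc x => ?_⟩
  have hterm : signedTerm A κ S I x = t * (∏ α ∈ I, ((χ α : ℤ) : ℝ)) *
      (minor A I * minor (vdm κ k).transpose I * Real.exp (∑ α ∈ I, phase κ α x)) := by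
    by_cases hb : I ∈ bases A
    · rw [signedTerm_of_mem hb, hS I hb]
      rfl
    · have h0 : minor A I = 0 := not_not.1 fun h0 => hb ⟨hI, h0⟩
      rw [signedTerm_of_notMem hb, h0]
      simp
  have hph : ∀ α : {α : Fin n // α ∉ core A},
      phase (fun α : {α : Fin n // α ∉ core A} => κ α) α x = phase κ α x := fun α => rfl
  rw [hterm, hM I hI hc, prod_subtype_compl_core _ hc, sum_subtype_compl_core _ hc, Real.exp_add,
    cbTerm, minor_mul_diagonal, eq_inv_mul_iff_mul_eq₀ (hu0 x)]
  simp only [hph, hu]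
  ring

theorem IsDeterminantal.isInducedByRowColumnSigns (hk : 0 < k) (hd : 2 ≤ d)
    (hκ : Function.Injective κ) (hA : (bases A).Nonempty) (h : IsDeterminantal d A κ S) :
    IsInducedByRowColumnSigns A S := by
  classical
  obtain ⟨κ', a', c, hc, h⟩ := h
  obtain ⟨M, C, hM⟩ := exists_contraction κ hA
  have hC := contraction_const_ne_zero hA hκ hM
  have hpar := fun {I : Finset (Fin n)} (hI : I ∈ bases A) => parameter_eq hd hκ hc h hI
  have hvdm : ∀ J : Finset {α : Fin n // α ∉ core A},
      (∀ α ∈ J, ∃ I ∈ bases A, (α : Fin n) ∈ I) →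
      minor (vdm κ' (k - (core A).card)).transpose J =
        minor (vdm (fun α : {α : Fin n // α ∉ core A} => κ α) (k - (core A).card)).transpose J := by
    refine fun J hJ => minor_congr fun i α hα => ?_
    obtain ⟨I, hI, hαI⟩ := hJ α hα
    simp [vdm, hpar hI α hαI]
  have hV : ∀ J : Finset {α : Fin n // α ∉ core A}, J.card = k - (core A).card →
      minor (vdm (fun α : {α : Fin n // α ∉ core A} => κ α)
        (k - (core A).card)).transpose J ≠ 0 := fun J hJ =>
    minor_vdm_ne_zero hJ (hκ.comp Subtype.val_injective).injOn
  have h0 : ∀ I : Finset (Fin n), I.card = k → core A ⊆ I →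
      minor a' (I.subtype fun α => α ∉ core A) *
        minor (vdm κ' (k - (core A).card)).transpose (I.subtype fun α => α ∉ core A) =
      c 0 * signedTerm A κ S I (0 : Fin d → ℝ) := by
    intro I hI hcI
    rw [← h I hI hcI 0]
    simp [cbTerm, phase_zero]
  have hbase : ∀ I (hI : I ∈ bases A), minor a' (I.subtype fun α => α ∉ core A) =
      c 0 * C * ((S ⟨I, hI⟩ : ℤ) : ℝ) * minor M (I.subtype fun α => α ∉ core A) := by
    intro I hI
    have h1 := h0 I hI.1 (core_subset hI)
    rw [hvdm _ fun α hα => ⟨I, hI, Finset.mem_subtype.1 hα⟩, signedTerm_of_mem hI, cbTerm,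
      hM I hI.1 (core_subset hI)] at h1
    apply mul_right_cancel₀ (hV _ (card_subtype_compl_core hI.1 (core_subset hI)))
    rw [h1]
    simp only [phase_zero, Finset.sum_const_zero, Real.exp_zero]
    ring
  have hM0 : ∀ I, I.card = k → core A ⊆ I →
      (minor M (I.subtype fun α => α ∉ core A) ≠ 0 ↔ I ∈ bases A) := by
    intro I hI hcI
    have h1 := hM I hI hcI
    have h2 := minor_vdm_ne_zero hI (hκ.injOn (s := (I : Set (Fin n))))
    have h3 := hV _ (card_subtype_compl_core hI hcI)
    constructor
    · exact fun hne => ⟨hI, fun e => mul_ne_zero hC (mul_ne_zero hne h3) (by rw [← h1, e, zero_mul])⟩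
    · exact fun hb e => mul_ne_zero hb.2 h2 (by rw [h1, e, zero_mul, mul_zero])
  -- On columns in no base `κ'` is unconstrained, so a term of `a'` may vanish through its
  -- Vandermonde factor while its minor does not. Zeroing these columns makes such minors vanish
  -- too.
  let b : Matrix (Fin (k - (core A).card)) {α : Fin n // α ∉ core A} ℝ :=
    Matrix.of fun i α => if ∃ I ∈ bases A, (α : Fin n) ∈ I then a' i α else 0
  have hb : ∀ J : Finset {α : Fin n // α ∉ core A},
      (∀ α ∈ J, ∃ I ∈ bases A, (α : Fin n) ∈ I) → minor b J = minor a' J :=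
    fun J hJ => minor_congr fun i α hα => if_pos (hJ α hα)
  have hbI : ∀ I (hI : I ∈ bases A), minor b (I.subtype fun α => α ∉ core A) =
      c 0 * C * ((S ⟨I, hI⟩ : ℤ) : ℝ) * minor M (I.subtype fun α => α ∉ core A) := by
    intro I hI
    rw [hb _ fun α hα => ⟨I, hI, Finset.mem_subtype.1 hα⟩, hbase I hI]
  have hD : c 0 * C ≠ 0 := mul_ne_zero (hc 0) hC
  have habs : ∀ J : Finset {α : Fin n // α ∉ core A}, J.card = k - (core A).card →
      |minor b J| = |c 0 * C| * |minor M J| := by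
    intro J hJ
    obtain ⟨I, hI, hcI, rfl⟩ := exists_subtype_compl_core_eq hA hJ
    by_cases hIb : I ∈ bases A
    · rw [hbI I hIb, abs_mul, abs_mul, abs_unit_cast, mul_one]
    · rw [not_not.1 fun hne => hIb ((hM0 I hI hcI).1 hne), abs_zero, mul_zero, abs_eq_zero]
      by_cases hl : ∀ α ∈ I.subtype fun α => α ∉ core A, ∃ I ∈ bases A, (α : Fin n) ∈ I
      · have h1 := h0 I hI hcI
        rw [signedTerm_of_notMem hIb, mul_zero, hvdm _ hl] at h1
        rw [hb _ hl]
        exact (mul_eq_zero.1 h1).resolve_right (hV _ hJ)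
      · obtain ⟨α, hα, hαl⟩ : ∃ α ∈ I.subtype fun α => α ∉ core A,
            ¬ ∃ I ∈ bases A, (α : Fin n) ∈ I := by
          by_contra hcon
          exact hl fun α hα => not_not.1 fun hn => hcon ⟨α, hα, hn⟩
        exact minor_eq_zero_of_column hα fun i => if_neg hαl
  obtain ⟨I₀, hI₀⟩ := hA
  obtain ⟨e, η, hη⟩ := exists_column_signs hD habs
    ⟨I₀.subtype fun α => α ∉ core A, card_subtype_compl_core hI₀.1 (core_subset hI₀),
      (hM0 I₀ hI₀.1 (core_subset hI₀)).2 hI₀⟩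
  have hS : ∀ I (hI : I ∈ bases A), c 0 * C * ((S ⟨I, hI⟩ : ℤ) : ℝ) =
      e * ∏ α ∈ I.subtype (fun α => α ∉ core A), ((η α : ℤ) : ℝ) := by
    intro I hI
    apply mul_right_cancel₀ ((hM0 I hI.1 (core_subset hI)).2 hI)
    rw [← hbI I hI, hη _ (card_subtype_compl_core hI.1 (core_subset hI))]
  -- One base suffices to show that the two constants differ only by a sign.
  have he : |e| = |c 0 * C| := by
    have h1 := congrArg abs (hS I₀ hI₀)
    rw [abs_mul, abs_mul e, abs_unit_cast, Finset.abs_prod] at h1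
    simpa [abs_unit_cast] using h1.symm
  obtain ⟨s, hs⟩ := exists_unit_mul_of_abs_eq he
  -- Coloops lie in every base, so their signs could only alter the constant; they are set to `1`.
  let χ : Fin n → ℤˣ := fun α => if hα : α ∉ core A then η ⟨α, hα⟩ else 1
  refine isInducedByRowColumnSigns_of_eq hk (c := s) (χ := χ) fun ⟨I, hI⟩ => ?_
  have h1 : ∏ α ∈ I, ((χ α : ℤ) : ℝ) =
      ∏ α ∈ I.subtype (fun α => α ∉ core A), ((η α : ℤ) : ℝ) := by
    rw [prod_subtype_compl_core _ (core_subset hI), Finset.prod_eq_one, one_mul]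
    · refine Finset.prod_congr rfl fun α _ => ?_
      simp only [χ, dif_pos α.2]
    · intro α hα
      simp [χ, hα]
  have h2 : ((S ⟨I, hI⟩ : ℤ) : ℝ) = (s : ℤ) * ∏ α ∈ I, ((χ α : ℤ) : ℝ) := by
    apply mul_left_cancel₀ hD
    rw [hS I hI, hs, h1]
    ring
  apply Units.ext
  rw [Units.val_mul, Units.coe_prod]
  exact_mod_cast h2

end Main

end Soliton

theorem mainTheorem3 {k n d : ℕ} (hk : 0 < k) (hd : 3 ≤ d)
    (A : Matrix (Fin k) (Fin n) ℝ) (hA : A.rank = k)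
    (κ : Fin n → ℝ) (hκ : Function.Injective κ) (S : Soliton.Signature A) :
    Soliton.IsDeterminantal d A κ S ↔ Soliton.IsInducedByRowColumnSigns A S :=
  ⟨fun h => h.isInducedByRowColumnSigns hk (by omega) hκ (Soliton.bases_nonempty hA),
    fun h => h.isDeterminantal hκ (Soliton.bases_nonempty hA)⟩
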